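/- Let $0<a<b$, let $f=(f_1,\dots,f_m)^T:[a,b]\to\mathbb{R}^m$ be continuously differentiable with components $f_1,\dots,f_m$ linearly independent on $[a,b]$, and let $\varepsilon=(\varepsilon_t)_{t\in[a,b]}$ be a Brownian motion on $[a,b]$, i.e. a centered Gaussian process with $\mathbb{E}[\varepsilon_s\varepsilon_t]=\min(s,t)$ and almost surely continuous paths. For $\theta\in\mathbb{R}^m$ consider the continuous time regression model $$Y_t=\theta^Tf(t)+\varepsilon_t,\qquad t\in[a,b],$$ in which the full trajectory of $Y$ is observed and $\theta$ is unknown. An estimator is an $\mathbb{R}^m$-valued function $T(Y)$ of the trajectory. It is linear if it is square integrable under every $\theta$ and there is a sequence of finite linear combinations $L_n(Y)=\sum_k Y_{t_{n,k}}w_{n,k}$ ($t_{n,k}\in[a,b]$, $w_{n,k}\in\mathbb{R}^m$), not depending on $\theta$, with $L_n(Y)\to T(Y)$ in $L^2$ under every $\theta$. It is unbiased if $\mathbb{E}_\theta[T(Y)]=\theta$ for all $\theta\in\mathbb{R}^m$. A linear unbiased estimator $T$ is a best linear unbiased estimator (BLUE) if, for every $\theta$ and every linear unbiased estimator $S$,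 the matrix $\mathrm{Cov}_\theta(S(Y))-\mathrm{Cov}_\theta(T(Y))$ is positive semidefinite. For a continuous function $g$ on $[a,b]$, $\int_a^b g(t)\,dY_t$ denotes the stochastic integral, that is, the $L^2$-limit of the sums $\sum_k g(t_k)(Y_{t_{k+1}}-Y_{t_k})$ over partitions of $[a,b]$ whose mesh tends to $0$. Put $$C=\int_a^b\dot f(t)\dot f(t)^T\,dt+\frac{f(a)f(a)^T}{a}.$$ Then $C$ is non-singular, the stochastic integrals $\int_a^b\dot f_i(t)\,dY_t$ ($i=1,\dots,m$) exist under every $\theta$, and a (measurable) BLUE exists. An estimator $\hat\theta_{\rm BLUE}$ is a BLUE if and only if, under every $\theta$, almost surely $$\hat\theta_{\rm BLUE}=C^{-1}\Big(\int_a^b\dot f(t)\,dY_t+\frac{f(a)}{a}Y_a\Big),$$ and the covariance matrix of the BLUE is, for every $\theta$, equal to $C^{-1}$. -/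

import Mathlib

open MeasureTheory ProbabilityTheory Filter Topology
open scoped ENNReal NNReal

namespace ContTimeRegression

noncomputable section

/-- `ε = (ε_t)_{t ∈ [a,b]}` is a Brownian motion on the interval `[a,b]` (`0 ≤ a`): a centered
Gaussian process with covariance kernel `K(s,t) = min s t` and almost surely continuous paths. -/
structure IsBrownianOn {Ω : Type*} [MeasurableSpace Ω] {a b : ℝ}
    (ε : Set.Icc a b → Ω → ℝ) (P : Measure Ω) : Prop where
  gaussian : IsGaussianProcess ε P
  centered : ∀ t, ∫ ω, ε t ω ∂P = 0
  kernel : ∀ s t, covariance (ε s) (ε t) P = min (s : ℝ) (t : ℝ)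
  continuous_paths : ∀ᵐ ω ∂P, Continuous fun t => ε t ω

/-- The restriction to `[a,b]` of a Brownian motion on `[0,∞)` is a Brownian motion on `[a,b]`. -/
theorem IsBrownianOn.of_isBrownianReal {Ω : Type*} [MeasurableSpace Ω] {a b : ℝ} (ha : 0 ≤ a)
    {B : ℝ≥0 → Ω → ℝ} {P : Measure Ω} (hB : IsBrownianReal B P) :
    IsBrownianOn (fun t : Set.Icc a b => B ⟨t, ha.trans t.2.1⟩) P where
  gaussian := hB.isGaussianProcess.comp_right (fun t : Set.Icc a b => ⟨t, ha.trans t.2.1⟩)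
  centered _ := hB.integral_eval _
  kernel s t :=
    (hB.covariance_eval ⟨s, ha.trans s.2.1⟩ ⟨t, ha.trans t.2.1⟩).trans (NNReal.coe_min _ _)
  continuous_paths := by
    filter_upwards [hB.cont] with ω h
    exact h.comp (by fun_prop)

/-- `I` is the stochastic integral `∫_a^b g(t) dX_t` of the (continuous, deterministic) integrand
`g` with respect to the process `X`: the limit in `L²(P)` of the sums
`∑ g(t_k) (X_{t_{k+1}} - X_{t_k})` over the partitions `a = t_0 ≤ t_1 ≤ ... ≤ t_N = b`, as the mesh
of the partition tends to `0`. -/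
def HasStochIntegral {Ω : Type*} [MeasurableSpace Ω] {a b : ℝ} (g : ℝ → ℝ)
    (X : Set.Icc a b → Ω → ℝ) (P : Measure Ω) (I : Ω → ℝ) : Prop :=
  MemLp I 2 P ∧
  ∀ η : ℝ≥0∞, 0 < η → ∃ δ : ℝ, 0 < δ ∧ ∀ (N : ℕ) (t : ℕ → Set.Icc a b), Monotone t →
    (t 0 : ℝ) = a → (t N : ℝ) = b → (∀ k < N, (t (k + 1) : ℝ) - (t k : ℝ) ≤ δ) →
    eLpNorm (fun ω => (∑ k ∈ Finset.range N, g (t k) * (X (t (k + 1)) ω - X (t k) ω)) - I ω) 2 P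
      ≤ η

open Classical in
/-- The stochastic integral `∫_a^b g(t) dX_t` (a version of it; `0` if it does not exist). -/
def stochIntegral {Ω : Type*} [MeasurableSpace Ω] {a b : ℝ} (g : ℝ → ℝ)
    (X : Set.Icc a b → Ω → ℝ) (P : Measure Ω) : Ω → ℝ :=
  if h : ∃ I, HasStochIntegral g X P I then h.choose else 0

/-- The observed process `Y_t = θᵀ f(t) + ε_t`, `t ∈ [a,b]`, when the parameter is `θ`. -/
def obs {Ω : Type*} {a b : ℝ} {m : ℕ} (f : ℝ → Fin m → ℝ) (ε : Set.Icc a b → Ω → ℝ)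
    (θ : Fin m → ℝ) : Set.Icc a b → Ω → ℝ :=
  fun t ω => θ ⬝ᵥ f t + ε t ω

/-- An estimator of `θ ∈ ℝ^m`: a function of the full trajectory of the process on `[a,b]`. -/
abbrev Estimator (a b : ℝ) (m : ℕ) : Type := (Set.Icc a b → ℝ) → Fin m → ℝ

/-- The random vector `T(Y)`, for an estimator `T` and a process `Y`. -/
def Estimator.eval {Ω : Type*} {a b : ℝ} {m : ℕ} (T : Estimator a b m)
    (Y : Set.Icc a b → Ω → ℝ) : Ω → Fin m → ℝ :=
  fun ω => T (fun t => Y t ω)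

/-- The estimator `y ↦ ∑ y(t) w_t` that uses finitely many observations, with weights
`w_t ∈ ℝ^m`. -/
def finiteLinear {a b : ℝ} {m : ℕ} (w : Set.Icc a b →₀ (Fin m → ℝ)) : Estimator a b m :=
  fun y => w.sum fun t v => y t • v

/-- Linear estimators in the model `(Y^θ)_θ` : square integrable, and the `L²(P)`-limits, under
every parameter `θ`, of a sequence (not depending on `θ`) of finite linear combinations
`∑ y(t) w_t` of the observations. -/
def IsLinearEstimator {Ω : Type*} [MeasurableSpace Ω] {a b : ℝ} {m : ℕ}
    (Y : (Fin m → ℝ) → Set.Icc a b → Ω → ℝ) (P : Measure Ω) (T : Estimator a b m) : Prop :=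
  (∀ θ i, MemLp (fun ω => T.eval (Y θ) ω i) 2 P) ∧
  ∃ w : ℕ → (Set.Icc a b →₀ (Fin m → ℝ)), ∀ θ i,
    Tendsto (fun n => eLpNorm
      (fun ω => (finiteLinear (w n)).eval (Y θ) ω i - T.eval (Y θ) ω i) 2 P) atTop (𝓝 0)

/-- `E_θ[T] = θ` for every `θ`. -/
def IsUnbiased {Ω : Type*} [MeasurableSpace Ω] {a b : ℝ} {m : ℕ}
    (Y : (Fin m → ℝ) → Set.Icc a b → Ω → ℝ) (P : Measure Ω) (T : Estimator a b m) : Prop :=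
  ∀ θ i, Integrable (fun ω => T.eval (Y θ) ω i) P ∧ ∫ ω, T.eval (Y θ) ω i ∂P = θ i

/-- The covariance matrix of a random vector. -/
def covMatrix {Ω : Type*} [MeasurableSpace Ω] {m : ℕ} (Z : Ω → Fin m → ℝ) (P : Measure Ω) :
    Matrix (Fin m) (Fin m) ℝ :=
  Matrix.of fun i j => covariance (fun ω => Z ω i) (fun ω => Z ω j) P

/-- `T` is a best linear unbiased estimator: it is linear and unbiased, and for every `θ` its
covariance matrix is minimal in the Loewner ordering among all linear unbiased estimators. -/
structure IsBLUE {Ω : Type*} [MeasurableSpace Ω] {a b : ℝ} {m : ℕ}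
    (Y : (Fin m → ℝ) → Set.Icc a b → Ω → ℝ) (P : Measure Ω) (T : Estimator a b m) : Prop where
  linear : IsLinearEstimator Y P T
  unbiased : IsUnbiased Y P T
  best : ∀ S : Estimator a b m, IsLinearEstimator Y P S → IsUnbiased Y P S →
    ∀ θ, (covMatrix (S.eval (Y θ)) P - covMatrix (T.eval (Y θ)) P).PosSemidef

/-- The derivative `ḟ` of `f` on `[a,b]` (one-sided at the end points). -/
def fdot {m : ℕ} (a b : ℝ) (f : ℝ → Fin m → ℝ) : ℝ → Fin m → ℝ :=
  fun t => derivWithin f (Set.Icc a b) t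

/-- The matrix `C = ∫_a^b ḟ(t) ḟ(t)ᵀ dt + f(a) f(a)ᵀ / a`. -/
def Cmat {m : ℕ} (a b : ℝ) (f : ℝ → Fin m → ℝ) : Matrix (Fin m) (Fin m) ℝ :=
  Matrix.of fun i j => (∫ t in a..b, fdot a b f t i * fdot a b f t j) + f a i * f a j / a

/-- The random vector `C⁻¹ (∫_a^b ḟ(t) dY_t + (f(a) / a) Y_a)`, for a process `Y` on `[a,b]`. -/
def blueFormula {Ω : Type*} [MeasurableSpace Ω] {a b : ℝ} (hab : a ≤ b) {m : ℕ}
    (f : ℝ → Fin m → ℝ) (Y : Set.Icc a b → Ω → ℝ) (P : Measure Ω) : Ω → Fin m → ℝ :=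
  fun ω => (Cmat a b f)⁻¹.mulVec fun i =>
    stochIntegral (fun t => fdot a b f t i) Y P ω + f a i / a * Y ⟨a, Set.left_mem_Icc.2 hab⟩ ω

end

end ContTimeRegression

/-! The argument takes place in the Hilbert space L²(P), where the noise is a curve `e` with ⟨e_s,
e_t⟩ = min(s,t). Mapping e_t - e_a to the indicator of (a,t] is isometric, so Riemann sums of
continuous integrands converge to Wiener integrals (`exists_wienerIntegral`). The scores Z_i = ∫ ḟ_i
dε + (f_i(a)/a) ε_a lie in the closed span of the noise, satisfy ⟨e_t, Z_i⟩ = f_i(t) by the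
fundamental theorem of calculus, and have Gram matrix C (`exists_score`). Testing against the e_t
shows that the Z_i inherit linear independence from the f_i, hence C is non-singular.

With h = ∑ θ_j Z_j, passing from ε to Y under θ is the bounded operator x ↦ x + ⟨h, x⟩
(`driftShift`). Limits of linear combinations can therefore be taken under θ = 0 and transported to
every θ. Linear unbiased estimators become θ + X, with X_i in the closed span of the noise and ⟨Z_j,
X_i⟩ = δ_ij (`isLinearEstimator_and_isUnbiased_iff`). Among such families C⁻¹Z has the smallest Gram
matrix, by Pythagoras: Gram(X) = C⁻¹ + Gram(X - C⁻¹Z) (`gram_eq_add_gram_sub_dualFamily`). This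
yields optimality and, since a zero Gram diagonal forces X = C⁻¹Z, uniqueness. Shifting C⁻¹Z by the
drift gives the explicit formula. -/

namespace ContTimeRegression

/-! ### Extending an isometric correspondence to closures -/

section Isometry

variable {V H K : Type*} [AddCommGroup V] [Module ℝ V]
  [NormedAddCommGroup H] [InnerProductSpace ℝ H] [NormedAddCommGroup K] [InnerProductSpace ℝ K]
  {A : V →ₗ[ℝ] H} {B : V →ₗ[ℝ] K}

/-- `(x, y)` belongs to the closure of the graph of the correspondence `A c ↔ B c`. -/
def Corresponds (A : V →ₗ[ℝ] H) (B : V →ₗ[ℝ] K) (x : H) (y : K) : Prop :=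
  ∃ c : ℕ → V, Tendsto (fun n => A (c n)) atTop (𝓝 x) ∧ Tendsto (fun n => B (c n)) atTop (𝓝 y)

theorem Corresponds.map (A : V →ₗ[ℝ] H) (B : V →ₗ[ℝ] K) (c : V) : Corresponds A B (A c) (B c) :=
  ⟨fun _ => c, tendsto_const_nhds, tendsto_const_nhds⟩

theorem Corresponds.sub {x x' : H} {y y' : K} (h : Corresponds A B x y)
    (h' : Corresponds A B x' y') : Corresponds A B (x - x') (y - y') := by
  obtain ⟨c, h1, h2⟩ := h
  obtain ⟨d, h3, h4⟩ := h'
  exact ⟨fun n => c n - d n, by simpa using h1.sub h3, by simpa using h2.sub h4⟩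

theorem Corresponds.inner_eq (hAB : ∀ c d, inner ℝ (A c) (A d) = inner ℝ (B c) (B d))
    {x x' : H} {y y' : K} (h : Corresponds A B x y) (h' : Corresponds A B x' y') :
    inner ℝ x x' = inner ℝ y y' := by
  obtain ⟨c, h1, h2⟩ := h
  obtain ⟨d, h3, h4⟩ := h'
  refine tendsto_nhds_unique (h1.inner h3) ?_
  simpa only [hAB] using h2.inner (𝕜 := ℝ) h4

theorem Corresponds.norm_eq (hAB : ∀ c d, inner ℝ (A c) (A d) = inner ℝ (B c) (B d))
    {x : H} {y : K} (h : Corresponds A B x y) : ‖x‖ = ‖y‖ := by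
  rw [norm_eq_sqrt_real_inner, norm_eq_sqrt_real_inner, h.inner_eq hAB h]

/-- Equality of the Gram forms makes `A (c n)` Cauchy whenever `B (c n)` is, and completeness of `H`
supplies the limit. -/
theorem exists_corresponds [CompleteSpace H]
    (hAB : ∀ c d, inner ℝ (A c) (A d) = inner ℝ (B c) (B d))
    {y : K} (hy : y ∈ closure (Set.range B)) : ∃ x, Corresponds A B x y := by
  obtain ⟨u, hu, hlim⟩ := mem_closure_iff_seq_limit.1 hy
  choose c hc using hu
  have hc' : (fun n => B (c n)) = u := funext hc
  have hcauchy : CauchySeq fun n => A (c n) := by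
    have := hlim.cauchySeq
    rw [← hc'] at this
    rw [Metric.cauchySeq_iff] at this ⊢
    intro η hη
    obtain ⟨N, hN⟩ := this η hη
    refine ⟨N, fun p hp q hq => ?_⟩
    have := hN p hp q hq
    rw [dist_eq_norm, ← map_sub] at this ⊢
    rwa [(Corresponds.map A B (c p - c q)).norm_eq hAB]
  obtain ⟨x, hx⟩ := cauchySeq_tendsto_of_complete hcauchy
  exact ⟨x, c, hx, hc' ▸ hlim⟩

end Isometry

/-! ### Step functions in L²((a,b]) -/

section StepFunctions

variable {a b : ℝ}

/-- A step function over a partition takes, at a point covered by the partition, a value of its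
coefficient function at a nearby point. -/
theorem step_sum_eq {g : ℝ → ℝ} {t : ℕ → ℝ} (ht : Monotone t) {η x : ℝ} (h0 : t 0 < x) (N : ℕ)
    (hη : ∀ k < N, t k < x → x ≤ t (k + 1) → |g (t k) - g x| ≤ η) :
    (t N < x → ∑ k ∈ Finset.range N, g (t k) *
      ((Set.Iic (t (k + 1))).indicator 1 x - (Set.Iic (t k)).indicator 1 x) = 0) ∧
    (x ≤ t N → |∑ k ∈ Finset.range N, g (t k) *
      ((Set.Iic (t (k + 1))).indicator 1 x - (Set.Iic (t k)).indicator 1 x) - g x| ≤ η) := by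
  -- Only the index with t k < x ≤ t (k + 1) contributes at x, with indicator difference 1. The
  -- vanishing claim for t N < x is what lets the induction start the sum afresh at that index.
  induction N with
  | zero => exact ⟨by simp, fun h => absurd h0 h.not_gt⟩
  | succ n ih =>
    obtain ⟨ih1, ih2⟩ := ih fun k hk => hη k (hk.trans n.lt_succ_self)
    have hle : t n ≤ t (n + 1) := ht n.le_succ
    rw [Finset.sum_range_succ]
    refine ⟨fun h => ?_, fun h => ?_⟩
    · rw [ih1 (hle.trans_lt h)]
      simp [h, hle.trans_lt h]
    · rcases lt_or_ge (t n) x with h' | h'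
      · rw [ih1 h']
        simpa [h, h'] using hη n n.lt_succ_self h' h
      · simpa [h, h'] using ih2 h'

/-- A uniformly fine partition of `[a,b]`. -/
theorem exists_partition (hab : a ≤ b) {δ : ℝ} (hδ : 0 < δ) :
    ∃ (N : ℕ) (t : ℕ → Set.Icc a b), Monotone t ∧ (t 0 : ℝ) = a ∧ (t N : ℝ) = b ∧
      ∀ k < N, (t (k + 1) : ℝ) - (t k : ℝ) ≤ δ := by
  obtain ⟨N, hN⟩ := exists_nat_ge ((b - a) / δ)
  rw [div_le_iff₀ hδ] at hN
  -- Truncation by `projIcc` keeps the sequence at b once b is reached, so it is monotone on all of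
  -- ℕ.
  refine ⟨N, fun k => Set.projIcc a b hab (a + k * δ), fun k l hkl => ?_, ?_, ?_, fun k _ => ?_⟩
  · apply Set.monotone_projIcc
    gcongr
  · simp [Set.projIcc, hab]
  · simp only [Set.projIcc]
    rw [min_eq_left (by linarith), max_eq_right hab]
  · simp only [Set.projIcc]
    push_cast
    rcases max_cases a (min b (a + (k + 1) * δ)) with h | h <;>
      rcases min_cases b (a + (k + 1) * δ) with h' | h' <;>
      rcases max_cases a (min b (a + k * δ)) with h'' | h'' <;>
      rcases min_cases b (a + k * δ) with h''' | h''' <;> linarith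

/-- The indicator function of `(-∞, t]` in `L²((a,b])`. -/
noncomputable def initialIndicator (a b t : ℝ) : Lp ℝ 2 (volume.restrict (Set.Ioc a b)) :=
  indicatorConstLp 2 (measurableSet_Iic (a := t)) (measure_ne_top _ _) (1 : ℝ)

/-- The value min s t - a is also the inner product of the Brownian increments from a to s and from
a to t; this is the source of the isometry. -/
theorem inner_initialIndicator {s t : ℝ} (hs : s ∈ Set.Icc a b) (ht : t ∈ Set.Icc a b) :
    inner ℝ (initialIndicator a b s) (initialIndicator a b t) = min s t - a := by
  rw [initialIndicator, initialIndicator, L2.real_inner_indicatorConstLp_one_indicatorConstLp_one,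
    measureReal_restrict_apply (measurableSet_Iic.inter measurableSet_Iic), Set.Iic_inter_Iic,
    Set.inter_comm, Set.Ioc_inter_Iic, Real.volume_real_Ioc_of_le]
  · rw [min_eq_right ((min_le_left _ _).trans hs.2)]
  · exact le_min (hs.1.trans hs.2) (le_min hs.1 ht.1)

theorem memLp_two_of_continuousOn {g : ℝ → ℝ} (hg : ContinuousOn g (Set.Icc a b)) :
    MemLp g 2 (volume.restrict (Set.Ioc a b)) := by
  obtain ⟨M, hM⟩ := isCompact_Icc.exists_bound_of_continuousOn hg
  refine MemLp.of_bound ((hg.mono Set.Ioc_subset_Icc_self).aestronglyMeasurable measurableSet_Ioc)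
    M ?_
  filter_upwards [ae_restrict_mem measurableSet_Ioc] with x hx using hM x ⟨hx.1.le, hx.2⟩

theorem inner_initialIndicator_toLp {g : ℝ → ℝ} (hg : ContinuousOn g (Set.Icc a b)) {t : ℝ}
    (ht : t ∈ Set.Icc a b) :
    inner ℝ (initialIndicator a b t) (memLp_two_of_continuousOn hg).toLp = ∫ x in a..t, g x := by
  rw [initialIndicator, L2.inner_indicatorConstLp_one,
    setIntegral_congr_ae₀ measurableSet_Iic.nullMeasurableSet (g := g)
      ((memLp_two_of_continuousOn hg).coeFn_toLp.mono fun x hx _ => hx),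
    Measure.restrict_restrict measurableSet_Iic, Set.inter_comm, Set.Ioc_inter_Iic,
    min_eq_right ht.2, intervalIntegral.integral_of_le ht.1]

theorem inner_toLp_toLp_of_continuousOn (hab : a ≤ b) {g g' : ℝ → ℝ}
    (hg : ContinuousOn g (Set.Icc a b)) (hg' : ContinuousOn g' (Set.Icc a b)) :
    inner ℝ (memLp_two_of_continuousOn hg).toLp (memLp_two_of_continuousOn hg').toLp =
      ∫ x in a..b, g x * g' x := by
  rw [L2.inner_def, intervalIntegral.integral_of_le hab]
  refine integral_congr_ae ?_
  filter_upwards [(memLp_two_of_continuousOn hg).coeFn_toLp,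
    (memLp_two_of_continuousOn hg').coeFn_toLp] with x h h'
  simp [h, h', mul_comm]

/-- The step functions approximating a continuous function converge to it in `L²((a,b])`. -/
theorem norm_step_sub_le {g : ℝ → ℝ} (hg : ContinuousOn g (Set.Icc a b)) {η : ℝ}
    (hη : 0 < η) :
    ∃ δ : ℝ, 0 < δ ∧ ∀ (N : ℕ) (t : ℕ → Set.Icc a b), Monotone t →
      (t 0 : ℝ) = a → (t N : ℝ) = b → (∀ k < N, (t (k + 1) : ℝ) - (t k : ℝ) ≤ δ) →
      ‖(∑ k ∈ Finset.range N, g (t k) •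
        (initialIndicator a b (t (k + 1)) - initialIndicator a b (t k))) -
          (memLp_two_of_continuousOn hg).toLp‖ ≤ η := by
  -- c is the square root of the total mass, the factor by which a uniform bound controls the L²
  -- norm; dividing η by c + 1 avoids a zero denominator.
  set c : ℝ := ((measureUnivNNReal (volume.restrict (Set.Ioc a b)) : ℝ)) ^ ((2 : ℝ≥0∞).toReal)⁻¹
    with hc
  have hc0 : 0 ≤ c := by positivity
  have hη' : 0 < η / (c + 1) := by positivity
  obtain ⟨δ, hδ, hδg⟩ := Metric.uniformContinuousOn_iff_le.1
    (isCompact_Icc.uniformContinuousOn_of_continuous hg) _ hη'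
  refine ⟨δ, hδ, fun N t ht h0 hN hmesh => ?_⟩
  refine (Lp.norm_le_of_ae_bound hη'.le ?_).trans (b := c * (η / (c + 1))) ?_
  · have h1 : ∀ s : ℝ, initialIndicator a b s =ᵐ[volume.restrict (Set.Ioc a b)]
        (Set.Iic s).indicator fun _ => (1 : ℝ) := fun s => indicatorConstLp_coeFn
    have h2 : ∀ k, (g (t k) • (initialIndicator a b (t (k + 1)) - initialIndicator a b (t k)) :
        Lp ℝ 2 (volume.restrict (Set.Ioc a b))) =ᵐ[volume.restrict (Set.Ioc a b)] fun x =>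
          g (t k) * ((Set.Iic (t (k + 1) : ℝ)).indicator 1 x -
            (Set.Iic (t k : ℝ)).indicator 1 x) := by
      intro k
      filter_upwards [h1 (t k), h1 (t (k + 1)), Lp.coeFn_sub (initialIndicator a b (t (k + 1)))
        (initialIndicator a b (t k)), Lp.coeFn_smul (g (t k))
        (initialIndicator a b (t (k + 1)) - initialIndicator a b (t k))] with x h1 h2 h3 h4
      rw [h4, Pi.smul_apply, h3, Pi.sub_apply, h1, h2]
      rfl
    filter_upwards [ae_restrict_mem measurableSet_Ioc, ae_all_iff.2 h2,
      (memLp_two_of_continuousOn hg).coeFn_toLp, Lp.coeFn_sub (∑ k ∈ Finset.range N, g (t k) •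
        (initialIndicator a b (t (k + 1)) - initialIndicator a b (t k)))
          (memLp_two_of_continuousOn hg).toLp, Lp.coeFn_finsetSum (Finset.range N) fun k => g (t k) •
        (initialIndicator a b (t (k + 1)) - initialIndicator a b (t k))] with x hx h2 h3 h4 h5
    rw [h4, Pi.sub_apply, h3, h5, Finset.sum_apply, Finset.sum_congr rfl fun k _ => h2 k,
      Real.norm_eq_abs]
    refine (step_sum_eq (t := fun k => (t k : ℝ)) (fun _ _ h => ht h) (by rw [h0]; exact hx.1) N
      fun k hk hkx hxk => ?_).2 (by rw [hN]; exact hx.2)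
    refine hδg _ (t k).2 _ ⟨hx.1.le, hx.2⟩ ?_
    rw [Real.dist_eq, abs_le]
    have := hmesh k hk
    constructor <;> linarith
  · rw [mul_div_assoc', div_le_iff₀ (by positivity)]
    nlinarith

end StepFunctions

/-- The Wiener integrals of continuous functions with respect to a family of vectors of a Hilbert
space whose Gram kernel is the one of the Brownian motion. -/
theorem exists_wienerIntegral {H ι : Type*} [NormedAddCommGroup H] [InnerProductSpace ℝ H]
    [CompleteSpace H] {a b : ℝ} (hab : a ≤ b) {e : Set.Icc a b → H}
    (he : ∀ s t, inner ℝ (e s) (e t) = min (s : ℝ) t) (g : ι → ℝ → ℝ)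
    (hg : ∀ i, ContinuousOn (g i) (Set.Icc a b)) :
    ∃ I : ι → H, (∀ i, I i ∈ (Submodule.span ℝ (Set.range e)).topologicalClosure) ∧
      (∀ i (t : Set.Icc a b), inner ℝ (e t) (I i) = ∫ x in a..t, g i x) ∧
      (∀ i j, inner ℝ (I i) (I j) = ∫ x in a..b, g i x * g j x) ∧
      ∀ i, ∀ η : ℝ, 0 < η → ∃ δ : ℝ, 0 < δ ∧ ∀ (N : ℕ) (t : ℕ → Set.Icc a b), Monotone t →
        (t 0 : ℝ) = a → (t N : ℝ) = b → (∀ k < N, (t (k + 1) : ℝ) - (t k : ℝ) ≤ δ) →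
        ‖(∑ k ∈ Finset.range N, g i (t k) • (e (t (k + 1)) - e (t k))) - I i‖ ≤ η := by
  set a₀ : Set.Icc a b := ⟨a, Set.left_mem_Icc.2 hab⟩
  set A : (Set.Icc a b →₀ ℝ) →ₗ[ℝ] H := Finsupp.linearCombination ℝ fun t => e t - e a₀ with hA
  set B : (Set.Icc a b →₀ ℝ) →ₗ[ℝ] _ :=
    Finsupp.linearCombination ℝ fun t : Set.Icc a b => initialIndicator a b t with hB
  have hAB : ∀ c d, inner ℝ (A c) (A d) = inner ℝ (B c) (B d) := by
    intro c d
    simp only [hA, hB, Finsupp.linearCombination_apply, Finsupp.sum_inner, Finsupp.inner_sum,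
      inner_smul_left, inner_smul_right]
    refine Finsupp.sum_congr fun s _ => ?_
    congr 1
    refine Finsupp.sum_congr fun t _ => ?_
    have h1 : a ≤ (s : ℝ) := s.2.1
    have h2 : a ≤ (t : ℝ) := t.2.1
    rw [inner_initialIndicator t.2 s.2]
    simp only [inner_sub_left, inner_sub_right, he, a₀, min_eq_left h1, min_eq_right h2, min_self]
    ring
  -- These coefficients encode a Riemann sum: `A` sends them to the stochastic sum and `B` to the
  -- step function, so convergence on the `B` side transfers.
  set σ : ι → ℕ → (ℕ → Set.Icc a b) → (Set.Icc a b →₀ ℝ) := fun i N t =>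
    ∑ k ∈ Finset.range N, g i (t k) • (Finsupp.single (t (k + 1)) 1 - Finsupp.single (t k) 1)
    with hσ
  have hAσ : ∀ i N t, A (σ i N t) =
      ∑ k ∈ Finset.range N, g i (t k) • (e (t (k + 1)) - e (t k)) := by
    intro i N t
    simp [hA, hσ, map_sum]
  have hBσ : ∀ i N t, B (σ i N t) = ∑ k ∈ Finset.range N, g i (t k) •
        (initialIndicator a b (t (k + 1)) - initialIndicator a b (t k)) := by
    intro i N t
    simp [hB, hσ, map_sum]
  have hmem : ∀ i, (memLp_two_of_continuousOn (hg i)).toLp ∈ closure (Set.range B) := by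
    intro i
    refine Metric.mem_closure_iff.2 fun η hη => ?_
    obtain ⟨δ, hδ, h⟩ := norm_step_sub_le (hg i) (half_pos hη)
    obtain ⟨N, t, h1, h2, h3, h4⟩ := exists_partition hab hδ
    refine ⟨_, ⟨σ i N t, rfl⟩, ?_⟩
    rw [dist_comm, dist_eq_norm, hBσ]
    exact (h N t h1 h2 h3 h4).trans_lt (half_lt_self hη)
  choose I hI using fun i => exists_corresponds hAB (hmem i)
  -- The initial value is uncorrelated with all later increments. Hence ⟨e t, I i⟩ = ⟨e t - e a₀, I
  -- i⟩, which is computed on the indicator side.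
  have hea : ∀ c, inner ℝ (e a₀) (A c) = 0 := by
    intro c
    rw [hA, Finsupp.linearCombination_apply, Finsupp.inner_sum]
    refine Finset.sum_eq_zero fun t _ => ?_
    have : a ≤ (t : ℝ) := t.2.1
    dsimp only
    rw [inner_smul_right, inner_sub_right, he, he, min_eq_left this, min_self, sub_self, mul_zero]
  have hAspan : ∀ c, A c ∈ Submodule.span ℝ (Set.range e) := fun c =>
    Submodule.sum_mem _ fun t _ => Submodule.smul_mem _ _ (Submodule.sub_mem _
      (Submodule.subset_span ⟨t, rfl⟩) (Submodule.subset_span ⟨a₀, rfl⟩))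
  refine ⟨I, fun i => ?_, fun i t => ?_, fun i j => ?_, fun i η hη => ?_⟩
  · obtain ⟨c, hc, -⟩ := hI i
    exact mem_closure_of_tendsto hc (Eventually.of_forall fun n => hAspan _)
  · have h0 : inner ℝ (e a₀) (I i) = 0 := by
      obtain ⟨c, hc, -⟩ := hI i
      refine tendsto_nhds_unique (tendsto_const_nhds.inner hc) ?_
      simpa only [hea] using tendsto_const_nhds
    have h1 := (Corresponds.map A B (Finsupp.single t 1)).inner_eq hAB (hI i)
    simp only [hA, hB, Finsupp.linearCombination_single, one_smul, inner_sub_left, h0,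
      sub_zero] at h1
    rw [h1, inner_initialIndicator_toLp (hg i) t.2]
  · rw [(hI i).inner_eq hAB (hI j), inner_toLp_toLp_of_continuousOn hab (hg i) (hg j)]
  · obtain ⟨δ, hδ, h⟩ := norm_step_sub_le (hg i) hη
    refine ⟨δ, hδ, fun N t h1 h2 h3 h4 => ?_⟩
    rw [← hAσ, ((Corresponds.map A B (σ i N t)).sub (hI i)).norm_eq hAB, hBσ]
    exact h N t h1 h2 h3 h4

theorem continuousOn_fdot {m : ℕ} {a b : ℝ} (hab : a < b) {f : ℝ → Fin m → ℝ}
    (hf : ContDiffOn ℝ 1 f (Set.Icc a b)) (i : Fin m) :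
    ContinuousOn (fun t => fdot a b f t i) (Set.Icc a b) :=
  (continuous_apply i).comp_continuousOn
    (hf.continuousOn_derivWithin (uniqueDiffOn_Icc hab) le_rfl)

theorem integral_fdot {m : ℕ} {a b : ℝ} (hab : a < b) {f : ℝ → Fin m → ℝ}
    (hf : ContDiffOn ℝ 1 f (Set.Icc a b)) (i : Fin m) {t : ℝ} (ht : t ∈ Set.Icc a b) :
    ∫ x in a..t, fdot a b f x i = f t i - f a i := by
  have hsub : Set.Icc a t ⊆ Set.Icc a b := Set.Icc_subset_Icc_right ht.2
  refine intervalIntegral.integral_eq_sub_of_hasDerivAt_of_le (f := fun x => f x i) ht.1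
    ((continuous_apply i).comp_continuousOn (hf.continuousOn.mono hsub)) (fun x hx => ?_) ?_
  · have hx' : x ∈ Set.Icc a b := hsub (Set.Ioo_subset_Icc_self hx)
    -- At interior points the derivative within [a,b] is the ordinary derivative.
    have h := ((hf.differentiableOn one_ne_zero) x hx').hasDerivWithinAt.hasDerivAt
      (Icc_mem_nhds hx.1 (hx.2.trans_le ht.2))
    exact hasDerivAt_pi.1 h i
  · exact ((continuousOn_fdot hab hf i).mono hsub).intervalIntegrable_of_Icc ht.1

/-- The score vectors of the regression model: they represent `f` and have Gram matrix `C`. -/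
theorem exists_score {H : Type*} [NormedAddCommGroup H] [InnerProductSpace ℝ H]
    [CompleteSpace H] {m : ℕ} {a b : ℝ} (ha : 0 < a) (hab : a < b) {f : ℝ → Fin m → ℝ}
    (hf : ContDiffOn ℝ 1 f (Set.Icc a b)) {e : Set.Icc a b → H}
    (he : ∀ s t, inner ℝ (e s) (e t) = min (s : ℝ) t) :
    ∃ Z : Fin m → H, (∀ i, Z i ∈ (Submodule.span ℝ (Set.range e)).topologicalClosure) ∧
      (∀ i t, inner ℝ (e t) (Z i) = f t i) ∧ Matrix.gram ℝ Z = Cmat a b f ∧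
      ∀ i, ∀ η : ℝ, 0 < η → ∃ δ : ℝ, 0 < δ ∧ ∀ (N : ℕ) (t : ℕ → Set.Icc a b), Monotone t →
        (t 0 : ℝ) = a → (t N : ℝ) = b → (∀ k < N, (t (k + 1) : ℝ) - (t k : ℝ) ≤ δ) →
        ‖(∑ k ∈ Finset.range N, fdot a b f (t k) i • (e (t (k + 1)) - e (t k))) -
          (Z i - (f a i / a) • e ⟨a, Set.left_mem_Icc.2 hab.le⟩)‖ ≤ η := by
  obtain ⟨I, hI1, hI2, hI3, hI4⟩ := exists_wienerIntegral hab.le he (fun i t => fdot a b f t i)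
    (continuousOn_fdot hab hf)
  set a₀ : Set.Icc a b := ⟨a, Set.left_mem_Icc.2 hab.le⟩ with ha₀
  have h0 : ∀ i, inner ℝ (e a₀) (I i) = 0 := fun i => by simp [hI2, a₀]
  -- Pairing e t with I i gives f_i(t) - f_i(a); since ⟨e t, e a₀⟩ = a, the added multiple of e a₀
  -- restores f_i(a). In the Gram matrix it contributes f(a)f(a)ᵀ/a, without cross terms.
  refine ⟨fun i => I i + (f a i / a) • e a₀, fun i => ?_, fun i t => ?_, ?_, fun i η hη => ?_⟩
  · exact Submodule.add_mem _ (hI1 i) (Submodule.smul_mem _ _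
      (Submodule.le_topologicalClosure _ (Submodule.subset_span ⟨a₀, rfl⟩)))
  · have h1 : a ≤ (t : ℝ) := t.2.1
    rw [inner_add_right, inner_smul_right, hI2, he, integral_fdot hab hf i t.2]
    simp only [a₀, min_eq_right h1]
    field_simp
    ring
  · ext i j
    rw [Matrix.gram_apply, inner_add_left, inner_add_right, inner_add_right, hI3, inner_smul_left,
      inner_smul_right, inner_smul_right, inner_smul_left, h0, real_inner_comm, h0, he]
    simp only [Cmat, Matrix.of_apply, a₀, min_self, RCLike.conj_to_real]
    field_simp
    ring
  · obtain ⟨δ, hδ, h⟩ := hI4 i η hη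
    exact ⟨δ, hδ, fun N t h1 h2 h3 h4 => by simpa using h N t h1 h2 h3 h4⟩

/-- Vectors that represent linearly independent functions have a nonsingular Gram matrix. -/
theorem isUnit_det_gram {H ι τ : Type*} [NormedAddCommGroup H] [InnerProductSpace ℝ H]
    [Fintype ι] [DecidableEq ι] {e : τ → H} {Z : ι → H} {φ : τ → ι → ℝ}
    (hZ : ∀ i t, inner ℝ (e t) (Z i) = φ t i)
    (hlin : LinearIndependent ℝ fun (i : ι) (t : τ) => φ t i) :
    IsUnit (Matrix.gram ℝ Z).det := by
  rw [isUnit_iff_ne_zero, Matrix.det_gram_ne_zero_iff_linearIndependent]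
  rw [Fintype.linearIndependent_iff] at hlin ⊢
  refine fun v hv => hlin v ?_
  ext t
  have : inner ℝ (e t) (∑ i, v i • Z i) = 0 := by rw [hv, inner_zero_right]
  simpa [inner_sum, inner_smul_right, hZ] using this

/-! ### Stochastic integrals and drift shifts in L²(P) -/

section Probability

variable {Ω : Type*} [MeasurableSpace Ω] {P : Measure Ω} {a b : ℝ}

theorem hasStochIntegral_of_norm_le {g : ℝ → ℝ} {Y : Set.Icc a b → Ω → ℝ}
    {y : Set.Icc a b → Lp ℝ 2 P} (hY : ∀ t, Y t =ᵐ[P] y t) {I : Lp ℝ 2 P}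
    (hI : ∀ η : ℝ, 0 < η → ∃ δ : ℝ, 0 < δ ∧ ∀ (N : ℕ) (t : ℕ → Set.Icc a b), Monotone t →
        (t 0 : ℝ) = a → (t N : ℝ) = b → (∀ k < N, (t (k + 1) : ℝ) - (t k : ℝ) ≤ δ) →
        ‖(∑ k ∈ Finset.range N, g (t k) • (y (t (k + 1)) - y (t k))) - I‖ ≤ η) :
    HasStochIntegral g Y P I := by
  refine ⟨Lp.memLp I, fun η hη => ?_⟩
  -- η may be infinite, so the real-valued estimate is applied to a finite r strictly between 0 and
  -- η.
  obtain ⟨r, hr0, hr⟩ := ENNReal.lt_iff_exists_nnreal_btwn.1 hη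
  obtain ⟨δ, hδ, h⟩ := hI r (by exact_mod_cast hr0)
  refine ⟨δ, hδ, fun N t h1 h2 h3 h4 => le_trans ?_ hr.le⟩
  have h5 := h N t h1 h2 h3 h4
  have h6 : ‖(∑ k ∈ Finset.range N, g (t k) • (y (t (k + 1)) - y (t k))) - I‖ₑ ≤ r := by
    rw [← ofReal_norm, ← ENNReal.ofReal_coe_nnreal]
    exact ENNReal.ofReal_le_ofReal h5
  rw [Lp.enorm_def] at h6
  refine (eLpNorm_congr_ae ?_).trans_le h6
  have h7 : ∀ k, (g (t k) • (y (t (k + 1)) - y (t k)) : Lp ℝ 2 P) =ᵐ[P]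
      fun ω => g (t k) * (Y (t (k + 1)) ω - Y (t k) ω) := by
    intro k
    filter_upwards [hY (t k), hY (t (k + 1)), Lp.coeFn_sub (y (t (k + 1))) (y (t k)),
      Lp.coeFn_smul (g (t k)) (y (t (k + 1)) - y (t k))] with ω e1 e2 e3 e4
    rw [e4, Pi.smul_apply, e3, Pi.sub_apply, e1, e2, smul_eq_mul]
  filter_upwards [ae_all_iff.2 h7, Lp.coeFn_sub (∑ k ∈ Finset.range N,
      g (t k) • (y (t (k + 1)) - y (t k))) I,
    Lp.coeFn_finsetSum (Finset.range N) fun k => g (t k) • (y (t (k + 1)) - y (t k))]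
    with ω e1 e2 e3
  rw [e2, Pi.sub_apply, e3, Finset.sum_apply, Finset.sum_congr rfl fun k _ => e1 k]

/-- Both candidates are close to the Riemann sum of a single partition fine enough for both. This
identifies the arbitrarily chosen version `stochIntegral` with any explicit limit. -/
theorem HasStochIntegral.ae_eq (hab : a ≤ b) {g : ℝ → ℝ} {Y : Set.Icc a b → Ω → ℝ}
    (hY : ∀ t, AEStronglyMeasurable (Y t) P) {I I' : Ω → ℝ} (hI : HasStochIntegral g Y P I)
    (hI' : HasStochIntegral g Y P I') : I =ᵐ[P] I' := by
  have hm := hI.1.aestronglyMeasurable.sub hI'.1.aestronglyMeasurable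
  suffices h : eLpNorm (I - I') 2 P = 0 by
    rw [eLpNorm_eq_zero_iff hm two_ne_zero] at h
    filter_upwards [h] with ω hω using sub_eq_zero.1 hω
  refine le_antisymm (ENNReal.le_of_forall_pos_le_add fun r hr _ => ?_) bot_le
  have hr2 : (0 : ℝ≥0∞) < ((r / 2 : ℝ≥0) : ℝ≥0∞) := by exact_mod_cast half_pos hr
  obtain ⟨δ, hδ, h⟩ := hI.2 _ hr2
  obtain ⟨δ', hδ', h'⟩ := hI'.2 _ hr2
  obtain ⟨N, t, h1, h2, h3, h4⟩ := exists_partition hab (lt_min hδ hδ')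
  set S : Ω → ℝ := fun ω => ∑ k ∈ Finset.range N, g (t k) * (Y (t (k + 1)) ω - Y (t k) ω) with hS
  have hSm : AEStronglyMeasurable S P :=
    Finset.aestronglyMeasurable_fun_sum _ fun k _ => ((hY _).sub (hY _)).const_mul _
  have e1 : eLpNorm (S - I) 2 P ≤ ((r / 2 : ℝ≥0) : ℝ≥0∞) :=
    h N t h1 h2 h3 fun k hk => (h4 k hk).trans (min_le_left _ _)
  have e2 : eLpNorm (S - I') 2 P ≤ ((r / 2 : ℝ≥0) : ℝ≥0∞) :=
    h' N t h1 h2 h3 fun k hk => (h4 k hk).trans (min_le_right _ _)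
  calc eLpNorm (I - I') 2 P = eLpNorm ((S - I') - (S - I)) 2 P := by
        congr 1
        abel
    _ ≤ eLpNorm (S - I') 2 P + eLpNorm (S - I) 2 P :=
        eLpNorm_sub_le (hSm.sub hI'.1.aestronglyMeasurable) (hSm.sub hI.1.aestronglyMeasurable)
          one_le_two
    _ ≤ ((r / 2 : ℝ≥0) : ℝ≥0∞) + ((r / 2 : ℝ≥0) : ℝ≥0∞) := add_le_add e2 e1
    _ = 0 + r := by
        rw [← ENNReal.coe_add, add_halves, zero_add]

theorem HasStochIntegral.stochIntegral {g : ℝ → ℝ} {Y : Set.Icc a b → Ω → ℝ} {I : Ω → ℝ}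
    (hI : HasStochIntegral g Y P I) : HasStochIntegral g Y P (stochIntegral g Y P) := by
  have h : ∃ I, HasStochIntegral g Y P I := ⟨I, hI⟩
  rw [ContTimeRegression.stochIntegral, dif_pos h]
  exact h.choose_spec

variable [IsProbabilityMeasure P]

theorem inner_const_one (x : Lp ℝ 2 P) : inner ℝ (Lp.const 2 P (1 : ℝ)) x = ∫ ω, x ω ∂P := by
  rw [L2.inner_def]
  exact integral_congr_ae (.of_forall fun ω => by simp)

/-- The translation `x ↦ x + ⟨h, x⟩` of centered random variables which corresponds to the change
of the drift of the observed process. -/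
noncomputable def driftShift (h : Lp ℝ 2 P) : Lp ℝ 2 P →L[ℝ] Lp ℝ 2 P :=
  ContinuousLinearMap.id ℝ _ + (innerSL ℝ h).smulRight (Lp.const 2 P (1 : ℝ))

theorem driftShift_apply (h x : Lp ℝ 2 P) :
    driftShift h x = x + inner ℝ h x • Lp.const 2 P (1 : ℝ) := rfl

theorem driftShift_coeFn (h x : Lp ℝ 2 P) :
    driftShift h x =ᵐ[P] fun ω => x ω + inner ℝ h x := by
  rw [driftShift_apply]
  filter_upwards [Lp.coeFn_add x (inner ℝ h x • Lp.const 2 P (1 : ℝ)),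
    Lp.coeFn_smul (inner ℝ h x) (Lp.const 2 P (1 : ℝ)), Lp.coeFn_const 2 P (1 : ℝ)] with ω h1 h2 h3
  rw [h1, Pi.add_apply, h2, Pi.smul_apply, h3]
  simp

/-- A continuous linear map transports the approximation by partition sums. -/
theorem norm_partition_sum_map_le {H : Type*} [NormedAddCommGroup H] [InnerProductSpace ℝ H]
    (D : H →L[ℝ] H) {g : ℝ → ℝ} {e : Set.Icc a b → H} {I : H}
    (hI : ∀ η : ℝ, 0 < η → ∃ δ : ℝ, 0 < δ ∧ ∀ (N : ℕ) (t : ℕ → Set.Icc a b), Monotone t →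
        (t 0 : ℝ) = a → (t N : ℝ) = b → (∀ k < N, (t (k + 1) : ℝ) - (t k : ℝ) ≤ δ) →
        ‖(∑ k ∈ Finset.range N, g (t k) • (e (t (k + 1)) - e (t k))) - I‖ ≤ η)
    (η : ℝ) (hη : 0 < η) : ∃ δ : ℝ, 0 < δ ∧ ∀ (N : ℕ) (t : ℕ → Set.Icc a b), Monotone t →
        (t 0 : ℝ) = a → (t N : ℝ) = b → (∀ k < N, (t (k + 1) : ℝ) - (t k : ℝ) ≤ δ) →
        ‖(∑ k ∈ Finset.range N, g (t k) • (D (e (t (k + 1))) - D (e (t k)))) - D I‖ ≤ η := by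
  obtain ⟨δ, hδ, h⟩ := hI (η / (‖D‖ + 1)) (by positivity)
  refine ⟨δ, hδ, fun N t h1 h2 h3 h4 => ?_⟩
  have h5 := h N t h1 h2 h3 h4
  rw [le_div_iff₀ (by positivity)] at h5
  have h6 := D.le_opNorm ((∑ k ∈ Finset.range N, g (t k) • (e (t (k + 1)) - e (t k))) - I)
  simp only [map_sub, map_sum, map_smul] at h6
  nlinarith [norm_nonneg ((∑ k ∈ Finset.range N, g (t k) • (e (t (k + 1)) - e (t k))) - I)]

end Probability

/-! ### Linear unbiased estimators in Hilbert space terms -/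

section Estimation

variable {Ω : Type*} [MeasurableSpace Ω] {P : Measure Ω} {a b : ℝ} {m : ℕ}

theorem finsupp_sum_ae_eq {τ : Type*} {Y : τ → Ω → ℝ} {y : τ → Lp ℝ 2 P}
    (hY : ∀ t, Y t =ᵐ[P] y t) (c : τ →₀ ℝ) :
    (fun ω => c.sum fun t r => r * Y t ω) =ᵐ[P] Finsupp.linearCombination ℝ y c := by
  rw [Finsupp.linearCombination_apply, Finsupp.sum]
  have h : ∀ᵐ ω ∂P, ∀ t ∈ c.support, (c t • y t : Lp ℝ 2 P) ω = c t * Y t ω := by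
    refine (ae_ball_iff c.support.countable_toSet).2 fun t _ => ?_
    filter_upwards [hY t, Lp.coeFn_smul (c t) (y t)] with ω e1 e2
    rw [e2, Pi.smul_apply, e1, smul_eq_mul]
  filter_upwards [h, Lp.coeFn_finsetSum c.support fun t => c t • y t] with ω e1 e2
  rw [e2, Finset.sum_apply, Finset.sum_congr rfl e1, Finsupp.sum]

/-- The `i`-th coordinate of a family of weights. -/
noncomputable def weightCoord (τ : Type*) (i : Fin m) : (τ →₀ (Fin m → ℝ)) →ₗ[ℝ] (τ →₀ ℝ) :=
  Finsupp.mapRange.linearMap (LinearMap.proj i)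

theorem exists_weightCoord_eq {τ : Type*} (c : Fin m → τ →₀ ℝ) :
    ∃ w : τ →₀ (Fin m → ℝ), ∀ i, weightCoord τ i w = c i := by
  refine ⟨∑ j, Finsupp.mapRange.linearMap (LinearMap.single ℝ (fun _ => ℝ) j) (c j), fun i => ?_⟩
  ext t
  simp [weightCoord, Finsupp.finsetSum_apply, Pi.single_apply]

theorem finiteLinear_apply (w : Set.Icc a b →₀ (Fin m → ℝ)) (y : Set.Icc a b → ℝ) (i : Fin m) :
    finiteLinear w y i = (weightCoord _ i w).sum fun t r => r * y t := by
  rw [weightCoord, Finsupp.mapRange.linearMap_apply, Finsupp.sum_mapRange_index (by simp)]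
  simp [finiteLinear, Finsupp.sum, Finset.sum_apply, mul_comm]

theorem inner_eq_zero_of_mem_closure {H τ : Type*} [NormedAddCommGroup H]
    [InnerProductSpace ℝ H] {e : τ → H} {u x : H} (he : ∀ t, inner ℝ u (e t) = 0)
    (hx : x ∈ (Submodule.span ℝ (Set.range e)).topologicalClosure) : inner ℝ u x = 0 := by
  have h : (Submodule.span ℝ (Set.range e)).topologicalClosure ≤
      LinearMap.ker (innerSL ℝ u : H →L[ℝ] ℝ).toLinearMap := by
    refine Submodule.topologicalClosure_minimal _ (Submodule.span_le.2 ?_)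
      (innerSL ℝ u).isClosed_ker
    rintro _ ⟨t, rfl⟩
    exact he t
  exact h hx

theorem exists_seq_linearCombination {H τ : Type*} [NormedAddCommGroup H]
    [InnerProductSpace ℝ H] {e : τ → H} {x : H}
    (hx : x ∈ (Submodule.span ℝ (Set.range e)).topologicalClosure) :
    ∃ c : ℕ → (τ →₀ ℝ), Tendsto (fun n => Finsupp.linearCombination ℝ e (c n)) atTop (𝓝 x) := by
  obtain ⟨u, hu, hlim⟩ := mem_closure_iff_seq_limit.1 hx
  have : ∀ n, ∃ c, Finsupp.linearCombination ℝ e c = u n := fun n => by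
    have := hu n
    rwa [← Finsupp.range_linearCombination] at this
  choose c hc using this
  exact ⟨c, by simpa only [hc] using hlim⟩

theorem linearCombination_map {H τ : Type*} [NormedAddCommGroup H] [InnerProductSpace ℝ H]
    (D : H →L[ℝ] H) (e : τ → H) (c : τ →₀ ℝ) :
    Finsupp.linearCombination ℝ (fun t => D (e t)) c = D (Finsupp.linearCombination ℝ e c) := by
  simp [Finsupp.linearCombination_apply, map_finsuppSum]

variable [IsProbabilityMeasure P]

theorem driftShift_zero (x : Lp ℝ 2 P) : driftShift 0 x = x := by
  simp [driftShift_apply]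

/-- Every limit of finite linear combinations of the observations is, under all drifts
simultaneously, almost surely a measurable function of the trajectory. -/
theorem exists_measurable_version {e : Set.Icc a b → Lp ℝ 2 P} {x : Lp ℝ 2 P}
    (hx : x ∈ (Submodule.span ℝ (Set.range e)).topologicalClosure) :
    ∃ V : (Set.Icc a b → ℝ) → ℝ, Measurable V ∧ ∀ (h : Lp ℝ 2 P) (Y : Set.Icc a b → Ω → ℝ),
      (∀ t, Y t =ᵐ[P] driftShift h (e t)) →
        (fun ω => V fun t => Y t ω) =ᵐ[P] driftShift h x := by
  obtain ⟨c, hc⟩ := exists_seq_linearCombination hx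
  obtain ⟨ns, hns, hae⟩ := (tendstoInMeasure_of_tendsto_Lp hc).exists_seq_tendsto_ae
  -- The limsup is measurable on all trajectories and equals the limit where there is one. The
  -- subsequence is fixed before the drift h, so one function serves all drifts.
  refine ⟨fun y => limsup (fun k => (c (ns k)).sum fun t r => r * y t) atTop, ?_, fun h Y hY => ?_⟩
  · refine Measurable.limsup fun k => ?_
    exact Finset.measurable_fun_sum _ fun t _ => (measurable_pi_apply t).const_mul _
  · have h1 : ∀ k, (fun ω => (c (ns k)).sum fun t r => r * Y t ω) =ᵐ[P] fun ω =>
        (Finsupp.linearCombination ℝ e (c (ns k)) : Lp ℝ 2 P) ω +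
          inner ℝ h (Finsupp.linearCombination ℝ e (c (ns k))) := fun k => by
      refine (finsupp_sum_ae_eq hY _).trans ?_
      rw [linearCombination_map]
      exact driftShift_coeFn _ _
    have h2 : Tendsto (fun k => inner ℝ h (Finsupp.linearCombination ℝ e (c (ns k)))) atTop
        (𝓝 (inner ℝ h x)) := tendsto_const_nhds.inner (hc.comp hns.tendsto_atTop)
    filter_upwards [ae_all_iff.2 h1, hae, driftShift_coeFn h x] with ω e1 e2 e3
    rw [e3]
    refine Tendsto.limsup_eq ?_
    simp only [e1]
    exact e2.add h2

variable {Y : (Fin m → ℝ) → Set.Icc a b → Ω → ℝ} {e : Set.Icc a b → Lp ℝ 2 P}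
  {Z : Fin m → Lp ℝ 2 P}

theorem finiteLinear_eval_ae_eq (hY : ∀ θ t, Y θ t =ᵐ[P] driftShift (∑ j, θ j • Z j) (e t))
    (w : Set.Icc a b →₀ (Fin m → ℝ)) (θ : Fin m → ℝ) (i : Fin m) :
    (fun ω => (finiteLinear w).eval (Y θ) ω i) =ᵐ[P]
      driftShift (∑ j, θ j • Z j) (Finsupp.linearCombination ℝ e (weightCoord _ i w)) := by
  simp only [Estimator.eval, finiteLinear_apply]
  rw [← linearCombination_map]
  exact finsupp_sum_ae_eq (hY θ) _

/-- The linear unbiased estimators are, under every parameter `θ`, of the form `θ + X` with a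
centered `X` that is a limit of linear combinations of the noise and biorthogonal to the scores. -/
theorem isLinearEstimator_and_isUnbiased_iff
    (hY : ∀ θ t, Y θ t =ᵐ[P] driftShift (∑ j, θ j • Z j) (e t))
    (he : ∀ t, inner ℝ (Lp.const 2 P (1 : ℝ)) (e t) = 0) (T : Estimator a b m) :
    (IsLinearEstimator Y P T ∧ IsUnbiased Y P T) ↔
      ∃ X : Fin m → Lp ℝ 2 P, (∀ i, X i ∈ (Submodule.span ℝ (Set.range e)).topologicalClosure) ∧
        (∀ (θ : Fin m → ℝ) i, inner ℝ (∑ j, θ j • Z j) (X i) = θ i) ∧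
        ∀ θ i, (fun ω => T.eval (Y θ) ω i) =ᵐ[P] fun ω => X i ω + θ i := by
  constructor
  · rintro ⟨⟨hT2, w, hw⟩, hTu⟩
    have h1 : ∀ θ i, Tendsto (fun n => driftShift (∑ j, θ j • Z j)
        (Finsupp.linearCombination ℝ e (weightCoord _ i (w n)))) atTop (𝓝 (hT2 θ i).toLp) := by
      intro θ i
      rw [Lp.tendsto_Lp_iff_tendsto_eLpNorm]
      refine (hw θ i).congr fun n => eLpNorm_congr_ae ?_
      exact (finiteLinear_eval_ae_eq hY (w n) θ i).sub .rfl
    -- Under θ = 0 the shift is the identity, so T(Y⁰) itself is the candidate X.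
    have h2 : ∀ i, Tendsto (fun n => Finsupp.linearCombination ℝ e (weightCoord _ i (w n)))
        atTop (𝓝 (hT2 0 i).toLp) := by
      intro i
      simpa [driftShift_zero] using h1 0 i
    have hmem : ∀ i, (hT2 0 i).toLp ∈ (Submodule.span ℝ (Set.range e)).topologicalClosure :=
      fun i => mem_closure_of_tendsto (h2 i) (Eventually.of_forall fun n => by
        rw [← Finsupp.range_linearCombination]
        exact ⟨_, rfl⟩)
    have h3 : ∀ θ i, (fun ω => T.eval (Y θ) ω i) =ᵐ[P] fun ω => (hT2 0 i).toLp _ ω +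
        inner ℝ (∑ j, θ j • Z j) (hT2 0 i).toLp := by
      intro θ i
      -- By continuity of the shift, the same weights converge under θ to the shifted X; hence
      -- T(Y^θ) is determined by T(Y⁰).
      have := tendsto_nhds_unique (h1 θ i)
        (((driftShift (∑ j, θ j • Z j)).continuous.tendsto _).comp (h2 i))
      refine (hT2 θ i).coeFn_toLp.symm.trans ?_
      rw [this]
      exact driftShift_coeFn _ _
    -- X is centered, being in the closed span of centered vectors, so the mean of T(Y^θ) is exactly
    -- the drift term and unbiasedness prescribes it.
    have h4 : ∀ (θ : Fin m → ℝ) i, inner ℝ (∑ j, θ j • Z j) (hT2 0 i).toLp = θ i := by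
      intro θ i
      rw [← (hTu θ i).2, integral_congr_ae (h3 θ i),
        integral_add ((Lp.memLp _).integrable one_le_two) (integrable_const _), ← inner_const_one,
        inner_eq_zero_of_mem_closure he (hmem i)]
      simp
    refine ⟨fun i => (hT2 0 i).toLp, hmem, h4, fun θ i => ?_⟩
    have := h3 θ i
    rwa [h4] at this
  · rintro ⟨X, hX1, hX2, hX3⟩
    have h1 : ∀ θ i, (fun ω => T.eval (Y θ) ω i) =ᵐ[P] driftShift (∑ j, θ j • Z j) (X i) := by
      intro θ i
      refine (hX3 θ i).trans ?_
      filter_upwards [driftShift_coeFn (∑ j, θ j • Z j) (X i)] with ω hω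
      rw [hω, hX2]
    have h2 : ∀ θ i, MemLp (fun ω => T.eval (Y θ) ω i) 2 P := fun θ i =>
      (Lp.memLp _).ae_eq (h1 θ i).symm
    choose c hc using fun i => exists_seq_linearCombination (hX1 i)
    choose w hw using fun n => exists_weightCoord_eq fun i => c i n
    refine ⟨⟨h2, w, fun θ i => ?_⟩, fun θ i => ⟨(h2 θ i).integrable one_le_two, ?_⟩⟩
    · have h3 := ((driftShift (∑ j, θ j • Z j)).continuous.tendsto _).comp (hc i)
      have h4 := (Lp.tendsto_Lp_iff_tendsto_eLpNorm' _ _).1 h3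
      refine h4.congr fun n => eLpNorm_congr_ae ?_
      have h5 := finiteLinear_eval_ae_eq hY (w n) θ i
      rw [hw] at h5
      exact (h5.sub (h1 θ i)).symm
    · rw [integral_congr_ae (hX3 θ i),
        integral_add ((Lp.memLp _).integrable one_le_two) (integrable_const _), ← inner_const_one,
        inner_eq_zero_of_mem_closure he (hX1 i)]
      simp

/-- The mean θ drops out of covariances, so the Loewner comparison concerns Gram matrices that do
not depend on θ. -/
theorem covMatrix_eq_gram {S : Ω → Fin m → ℝ} {X : Fin m → Lp ℝ 2 P} {θ : Fin m → ℝ}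
    (hX : ∀ i, inner ℝ (Lp.const 2 P (1 : ℝ)) (X i) = 0)
    (hS : ∀ i, (fun ω => S ω i) =ᵐ[P] fun ω => X i ω + θ i) :
    covMatrix S P = Matrix.gram ℝ X := by
  have hmean : ∀ i, ∫ ω, S ω i ∂P = θ i := by
    intro i
    rw [integral_congr_ae (hS i),
      integral_add ((Lp.memLp _).integrable one_le_two) (integrable_const _), ← inner_const_one, hX]
    simp
  ext i j
  rw [covMatrix, Matrix.of_apply, Matrix.gram_apply, L2.inner_def, covariance, hmean, hmean]
  refine integral_congr_ae ?_
  filter_upwards [hS i, hS j] with ω h1 h2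
  simp [h1, h2, mul_comm]

end Estimation

/-! ### Biorthogonal families and the Gram matrix inequality -/

section DualFamily

variable {H ι : Type*} [NormedAddCommGroup H] [InnerProductSpace ℝ H] [Fintype ι] [DecidableEq ι]

/-- The family in the span of `Z` which is biorthogonal to `Z`. -/
noncomputable def dualFamily (Z : ι → H) (i : ι) : H :=
  ∑ j, (Matrix.gram ℝ Z)⁻¹ i j • Z j

variable {Z : ι → H}

theorem inner_dualFamily (hZ : IsUnit (Matrix.gram ℝ Z).det) (i j : ι) :
    inner ℝ (Z j) (dualFamily Z i) = (1 : Matrix ι ι ℝ) i j := by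
  rw [← Matrix.nonsing_inv_mul _ hZ, Matrix.mul_apply, dualFamily, inner_sum]
  refine Finset.sum_congr rfl fun k _ => ?_
  rw [inner_smul_right, Matrix.gram_apply, real_inner_comm]

/-- Biorthogonality reads off coefficients in the span of Z, so the value is the same for every
biorthogonal X, including the dual family. Thus X - dualFamily Z is orthogonal to the dual family.
-/
theorem inner_dualFamily_left {X : ι → H}
    (hX : ∀ i j, inner ℝ (Z j) (X i) = (1 : Matrix ι ι ℝ) i j) (i j : ι) :
    inner ℝ (dualFamily Z i) (X j) = (Matrix.gram ℝ Z)⁻¹ i j := by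
  simp [dualFamily, sum_inner, inner_smul_left, hX, Matrix.one_apply]

theorem gram_dualFamily (hZ : IsUnit (Matrix.gram ℝ Z).det) :
    Matrix.gram ℝ (dualFamily Z) = (Matrix.gram ℝ Z)⁻¹ := by
  ext i j
  exact inner_dualFamily_left (inner_dualFamily hZ) i j

/-- Among all families biorthogonal to `Z`, the dual family has the smallest Gram matrix. -/
theorem gram_eq_add_gram_sub_dualFamily (hZ : IsUnit (Matrix.gram ℝ Z).det) {X : ι → H}
    (hX : ∀ i j, inner ℝ (Z j) (X i) = (1 : Matrix ι ι ℝ) i j) :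
    Matrix.gram ℝ X = (Matrix.gram ℝ Z)⁻¹ + Matrix.gram ℝ (X - dualFamily Z) := by
  ext i j
  have h1 := inner_dualFamily_left hX i j
  have h2 : inner ℝ (X i) (dualFamily Z j) = (Matrix.gram ℝ Z)⁻¹ j i := by
    rw [real_inner_comm, inner_dualFamily_left hX]
  have h3 := inner_dualFamily_left (inner_dualFamily hZ) i j
  have h4 := inner_dualFamily_left (inner_dualFamily hZ) j i
  rw [real_inner_comm, h3] at h4
  simp only [Matrix.add_apply, Matrix.gram_apply, Pi.sub_apply, inner_sub_left, inner_sub_right,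
    h1, h2, h3, h4]
  ring

theorem inner_sum_smul_dualFamily (hZ : IsUnit (Matrix.gram ℝ Z).det) (θ : ι → ℝ) (i : ι) :
    inner ℝ (∑ j, θ j • Z j) (dualFamily Z i) = θ i := by
  simp [sum_inner, inner_smul_left, inner_dualFamily hZ, Matrix.one_apply]

theorem dualFamily_mem {K : Submodule ℝ H} (hZ : ∀ i, Z i ∈ K) (i : ι) : dualFamily Z i ∈ K :=
  Submodule.sum_mem _ fun j _ => Submodule.smul_mem _ _ (hZ j)

end DualFamily

/-! ### Gauss–Markov theorem and the explicit formula -/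

section BestEstimator

variable {Ω : Type*} [MeasurableSpace Ω] {P : Measure Ω} [IsProbabilityMeasure P] {a b : ℝ} {m : ℕ}
  {Y : (Fin m → ℝ) → Set.Icc a b → Ω → ℝ} {e : Set.Icc a b → Lp ℝ 2 P} {Z : Fin m → Lp ℝ 2 P}

theorem exists_measurable_eq_dualFamily
    (hY : ∀ θ t, Y θ t =ᵐ[P] driftShift (∑ j, θ j • Z j) (e t))
    (hZmem : ∀ i, Z i ∈ (Submodule.span ℝ (Set.range e)).topologicalClosure)
    (hZ : IsUnit (Matrix.gram ℝ Z).det) :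
    ∃ T : Estimator a b m, Measurable T ∧
      ∀ θ i, (fun ω => T.eval (Y θ) ω i) =ᵐ[P] fun ω => dualFamily Z i ω + θ i := by
  choose V hV1 hV2 using fun i => exists_measurable_version (dualFamily_mem hZmem i)
  refine ⟨fun y i => V i y, measurable_pi_iff.2 hV1, fun θ i => ?_⟩
  refine (hV2 i _ _ (hY θ)).trans ((driftShift_coeFn _ _).trans ?_)
  rw [inner_sum_smul_dualFamily hZ]

theorem covMatrix_of_eq_dualFamily (he : ∀ t, inner ℝ (Lp.const 2 P (1 : ℝ)) (e t) = 0)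
    (hZmem : ∀ i, Z i ∈ (Submodule.span ℝ (Set.range e)).topologicalClosure)
    (hZ : IsUnit (Matrix.gram ℝ Z).det) {S : Ω → Fin m → ℝ} {θ : Fin m → ℝ}
    (hS : ∀ i, (fun ω => S ω i) =ᵐ[P] fun ω => dualFamily Z i ω + θ i) :
    covMatrix S P = (Matrix.gram ℝ Z)⁻¹ := by
  rw [← gram_dualFamily hZ, covMatrix_eq_gram
    (fun i => inner_eq_zero_of_mem_closure he (dualFamily_mem hZmem i)) hS]

/-- The Gauss–Markov theorem: the best linear unbiased estimators are those given, under every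
parameter, by the family dual to the scores. -/
theorem isBLUE_iff (hY : ∀ θ t, Y θ t =ᵐ[P] driftShift (∑ j, θ j • Z j) (e t))
    (he : ∀ t, inner ℝ (Lp.const 2 P (1 : ℝ)) (e t) = 0)
    (hZmem : ∀ i, Z i ∈ (Submodule.span ℝ (Set.range e)).topologicalClosure)
    (hZ : IsUnit (Matrix.gram ℝ Z).det) (T : Estimator a b m) :
    IsBLUE Y P T ↔
      ∀ θ i, (fun ω => T.eval (Y θ) ω i) =ᵐ[P] fun ω => dualFamily Z i ω + θ i := by
  have hcov : ∀ S : Estimator a b m, IsLinearEstimator Y P S → IsUnbiased Y P S →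
      ∃ X : Fin m → Lp ℝ 2 P,
        (∀ θ i, (fun ω => S.eval (Y θ) ω i) =ᵐ[P] fun ω => X i ω + θ i) ∧
        ∀ θ, covMatrix (S.eval (Y θ)) P =
          (Matrix.gram ℝ Z)⁻¹ + Matrix.gram ℝ (X - dualFamily Z) := by
    intro S hS1 hS2
    obtain ⟨X, hX1, hX2, hX3⟩ := (isLinearEstimator_and_isUnbiased_iff hY he S).1 ⟨hS1, hS2⟩
    refine ⟨X, hX3, fun θ => ?_⟩
    rw [covMatrix_eq_gram (fun i => inner_eq_zero_of_mem_closure he (hX1 i)) (hX3 θ)]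
    refine gram_eq_add_gram_sub_dualFamily hZ fun i j => ?_
    have := hX2 (Pi.single j 1) i
    simpa [Pi.single_apply, Matrix.one_apply] using this
  have hgood : ∀ T : Estimator a b m,
      (∀ θ i, (fun ω => T.eval (Y θ) ω i) =ᵐ[P] fun ω => dualFamily Z i ω + θ i) →
      (IsLinearEstimator Y P T ∧ IsUnbiased Y P T) ∧
        ∀ θ, covMatrix (T.eval (Y θ)) P = (Matrix.gram ℝ Z)⁻¹ := fun T hT =>
    ⟨(isLinearEstimator_and_isUnbiased_iff hY he T).2
      ⟨dualFamily Z, dualFamily_mem hZmem, inner_sum_smul_dualFamily hZ, hT⟩,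
      fun θ => covMatrix_of_eq_dualFamily he hZmem hZ (hT θ)⟩
  constructor
  · intro hT
    obtain ⟨T₀, -, hT₀⟩ := exists_measurable_eq_dualFamily hY hZmem hZ
    obtain ⟨⟨h1, h2⟩, h3⟩ := hgood T₀ hT₀
    obtain ⟨X, hX, hXcov⟩ := hcov T hT.linear hT.unbiased
    -- Comparison with the explicit estimator at θ = 0 makes -Gram(X - dualFamily Z) positive
    -- semidefinite; its diagonal then forces each ‖X i - dualFamily Z i‖ to vanish.
    have h4 := hT.best T₀ h1 h2 0
    rw [h3, hXcov, sub_add_cancel_left] at h4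
    have h5 : ∀ i, X i = dualFamily Z i := fun i => by
      have := h4.diag_nonneg (i := i)
      rw [Matrix.neg_apply, Matrix.gram_apply, Pi.sub_apply, neg_nonneg] at this
      exact sub_eq_zero.1 (inner_self_eq_zero (𝕜 := ℝ).1
        (le_antisymm this real_inner_self_nonneg))
    intro θ i
    rw [← h5]
    exact hX θ i
  · intro hT
    obtain ⟨⟨h1, h2⟩, h3⟩ := hgood T hT
    refine ⟨h1, h2, fun S hS1 hS2 θ => ?_⟩
    obtain ⟨X, -, hXcov⟩ := hcov S hS1 hS2
    rw [h3, hXcov, add_sub_cancel_left]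
    exact Matrix.posSemidef_gram ℝ _

theorem dualFamily_add_ae_eq (hZ : IsUnit (Matrix.gram ℝ Z).det) (θ : Fin m → ℝ) :
    ∀ᵐ ω ∂P, ∀ i, dualFamily Z i ω + θ i =
      (Matrix.gram ℝ Z)⁻¹.mulVec (fun i => driftShift (∑ j, θ j • Z j) (Z i) ω) i := by
  rw [ae_all_iff]
  intro i
  have h : driftShift (∑ j, θ j • Z j) (dualFamily Z i) =
      ∑ k, (Matrix.gram ℝ Z)⁻¹ i k • driftShift (∑ j, θ j • Z j) (Z k) := by
    simp [dualFamily, map_sum]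
  filter_upwards [driftShift_coeFn (∑ j, θ j • Z j) (dualFamily Z i),
    Lp.coeFn_finsetSum Finset.univ fun k =>
      (Matrix.gram ℝ Z)⁻¹ i k • driftShift (∑ j, θ j • Z j) (Z k),
    ae_all_iff.2 fun k => Lp.coeFn_smul ((Matrix.gram ℝ Z)⁻¹ i k)
      (driftShift (∑ j, θ j • Z j) (Z k))] with ω h1 h2 h3
  -- Writing θ i as the drift of the dual vector turns the left side into a shifted vector, and the
  -- shift commutes with C⁻¹ by linearity.
  rw [← inner_sum_smul_dualFamily hZ θ i, ← h1, h, h2, Finset.sum_apply, Matrix.mulVec, dotProduct]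
  exact Finset.sum_congr rfl fun k _ => h3 k

/-- The explicit estimator is, under every parameter, given by the family dual to the scores. -/
theorem dualFamily_add_ae_eq_blueFormula (hab : a ≤ b) {f : ℝ → Fin m → ℝ}
    (hgram : Matrix.gram ℝ Z = Cmat a b f) (hZ : IsUnit (Matrix.gram ℝ Z).det) {θ : Fin m → ℝ}
    {X : Set.Icc a b → Ω → ℝ} (hX : ∀ t, X t =ᵐ[P] driftShift (∑ j, θ j • Z j) (e t))
    (hI : ∀ i, HasStochIntegral (fun t => fdot a b f t i) X P (driftShift (∑ j, θ j • Z j)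
      (Z i - (f a i / a) • e ⟨a, Set.left_mem_Icc.2 hab⟩))) :
    ∀ᵐ ω ∂P, ∀ i, dualFamily Z i ω + θ i = blueFormula hab f X P ω i := by
  have h1 := fun i => (hI i).stochIntegral.ae_eq hab
    (fun t => (Lp.aestronglyMeasurable _).congr (hX t).symm) (hI i)
  set D := driftShift (∑ j, θ j • Z j) with hD
  set a₀ : Set.Icc a b := ⟨a, Set.left_mem_Icc.2 hab⟩
  filter_upwards [dualFamily_add_ae_eq hZ θ, ae_all_iff.2 h1, hX a₀,
    ae_all_iff.2 fun i => Lp.coeFn_sub (D (Z i)) ((f a i / a) • D (e a₀)),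
    ae_all_iff.2 fun i => Lp.coeFn_smul (f a i / a) (D (e a₀))] with ω e1 e2 e3 e4 e5
  intro i
  rw [e1, hgram, blueFormula]
  congr 1
  ext k
  -- The multiple of e a₀ removed from Z to obtain the integral is put back by the term (f(a)/a)
  -- Y_a.
  rw [e2, e3, map_sub, map_smul, e4, Pi.sub_apply, e5, Pi.smul_apply, smul_eq_mul,
    sub_add_cancel]

end BestEstimator

/-! ### Brownian motion and the observed process as L² curves -/

section BrownianMotion

variable {Ω : Type*} [MeasurableSpace Ω] {P : Measure Ω} [IsProbabilityMeasure P] {a b : ℝ}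
  {ε : Set.Icc a b → Ω → ℝ}

/-- A Brownian motion as a curve in `L²(P)`. -/
theorem IsBrownianOn.exists_Lp (hε : IsBrownianOn ε P) :
    ∃ e : Set.Icc a b → Lp ℝ 2 P, (∀ t, ε t =ᵐ[P] e t) ∧
      (∀ s t, inner ℝ (e s) (e t) = min (s : ℝ) t) ∧
      ∀ t, inner ℝ (Lp.const 2 P (1 : ℝ)) (e t) = 0 := by
  have h : ∀ t, MemLp (ε t) 2 P := fun t => (hε.gaussian.hasGaussianLaw_eval t).memLp_two
  refine ⟨fun t => (h t).toLp, fun t => (h t).coeFn_toLp.symm, fun s t => ?_, fun t => ?_⟩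
  · rw [← hε.kernel, covariance_eq_sub (h s) (h t), hε.centered, zero_mul, sub_zero, L2.inner_def]
    refine integral_congr_ae ?_
    filter_upwards [(h s).coeFn_toLp, (h t).coeFn_toLp] with ω h1 h2
    simp [h1, h2, mul_comm]
  · rw [inner_const_one, integral_congr_ae (h t).coeFn_toLp, hε.centered]

/-- Since Z represents f, the regression drift θᵀf(t) is the inner product of e t with ∑ θ_j Z_j;
this places the model in the abstract setting. -/
theorem obs_ae_eq {e : Set.Icc a b → Lp ℝ 2 P} (he : ∀ t, ε t =ᵐ[P] e t) {m : ℕ}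
    {f : ℝ → Fin m → ℝ} {Z : Fin m → Lp ℝ 2 P} (hZ : ∀ i t, inner ℝ (e t) (Z i) = f t i)
    (θ : Fin m → ℝ) (t : Set.Icc a b) :
    obs f ε θ t =ᵐ[P] driftShift (∑ j, θ j • Z j) (e t) := by
  have h : inner ℝ (∑ j, θ j • Z j) (e t) = θ ⬝ᵥ f t := by
    rw [real_inner_comm, inner_sum]
    simp [inner_smul_right, hZ, dotProduct]
  filter_upwards [driftShift_coeFn (∑ j, θ j • Z j) (e t), he t] with ω h1 h2
  rw [h1, ← h2, h, obs, add_comm]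

end BrownianMotion

end ContTimeRegression

open ContTimeRegression in
theorem mainTheorem1 {Ω : Type*} [MeasurableSpace Ω] (P : Measure Ω) [IsProbabilityMeasure P]
    (m : ℕ) (a b : ℝ) (ha : 0 < a) (hab : a < b)
    (f : ℝ → Fin m → ℝ) (hf : ContDiffOn ℝ 1 f (Set.Icc a b))
    (hlin : LinearIndependent ℝ fun (i : Fin m) (t : Set.Icc a b) => f t i)
    (ε : Set.Icc a b → Ω → ℝ) (hε : ContTimeRegression.IsBrownianOn ε P) :
    -- the matrix `C` is non-singular
    IsUnit (ContTimeRegression.Cmat a b f).det ∧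
    -- the stochastic integrals `∫ ḟ_i dY` exist under every parameter
    (∀ θ i, ContTimeRegression.HasStochIntegral (fun t => ContTimeRegression.fdot a b f t i)
      (ContTimeRegression.obs f ε θ) P
      (ContTimeRegression.stochIntegral (fun t => ContTimeRegression.fdot a b f t i)
        (ContTimeRegression.obs f ε θ) P)) ∧
    -- a (measurable) best linear unbiased estimator exists
    (∃ T : ContTimeRegression.Estimator a b m, Measurable T ∧
      ContTimeRegression.IsBLUE (ContTimeRegression.obs f ε) P T) ∧
    -- an estimator is a BLUE if and only if it is given by the formula
    (∀ T : ContTimeRegression.Estimator a b m,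
      ContTimeRegression.IsBLUE (ContTimeRegression.obs f ε) P T ↔
        ∀ θ, T.eval (ContTimeRegression.obs f ε θ) =ᵐ[P]
          ContTimeRegression.blueFormula hab.le f (ContTimeRegression.obs f ε θ) P) ∧
    -- its covariance matrix is `C⁻¹`
    (∀ T : ContTimeRegression.Estimator a b m,
      ContTimeRegression.IsBLUE (ContTimeRegression.obs f ε) P T →
        ∀ θ, ContTimeRegression.covMatrix (T.eval (ContTimeRegression.obs f ε θ)) P =
          (ContTimeRegression.Cmat a b f)⁻¹) := by
  obtain ⟨e, hεe, hmin, he⟩ := hε.exists_Lp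
  obtain ⟨Z, hZmem, hZe, hgram, hZint⟩ := exists_score ha hab hf hmin
  have hdet : IsUnit (Matrix.gram ℝ Z).det := isUnit_det_gram hZe hlin
  have hY := obs_ae_eq hεe hZe
  have hstoch : ∀ θ i, HasStochIntegral (fun t => fdot a b f t i) (obs f ε θ) P
      (driftShift (∑ j, θ j • Z j) (Z i - (f a i / a) • e ⟨a, Set.left_mem_Icc.2 hab.le⟩)) :=
    fun θ i => hasStochIntegral_of_norm_le (y := fun t => driftShift (∑ j, θ j • Z j) (e t)) (hY θ)
      (norm_partition_sum_map_le (g := fun t => fdot a b f t i)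
        (driftShift (∑ j, θ j • Z j)) (hZint i))
  have hformula := fun θ =>
    dualFamily_add_ae_eq_blueFormula hab.le hgram hdet (hY θ) (hstoch θ)
  have hblue := isBLUE_iff hY he hZmem hdet
  refine ⟨?_, fun θ i => (hstoch θ i).stochIntegral, ?_, fun T => ?_, fun T hT θ => ?_⟩
  · rwa [← hgram]
  · obtain ⟨T, hT1, hT2⟩ := exists_measurable_eq_dualFamily hY hZmem hdet
    exact ⟨T, hT1, (hblue T).2 hT2⟩
  · rw [hblue]
    refine forall_congr' fun θ => ⟨fun h => ?_, fun h i => ?_⟩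
    · filter_upwards [ae_all_iff.2 h, hformula θ] with ω h1 h2
      ext i
      rw [h1, h2]
    · filter_upwards [h, hformula θ] with ω h1 h2
      rw [h1, h2]
  · rw [← hgram]
    exact covMatrix_of_eq_dualFamily he hZmem hdet ((hblue T).1 hT θ)
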